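/- Let $n$ be a nonnegative integer and let $A,B\subset\mathbb R^n$ be nonempty compact sets. For $1\le k\le n$ write $\pi_k(A)=\{x_k : x\in A\}$ and $\pi_k(B)=\{y_k : y\in B\}$. Let $\varphi=(\varphi_1,\dots,\varphi_n):A\times B\to\mathbb R^n$ be such that $\varphi_k(x,y)=\varphi_k(x_k,y_k)$ depends only on the $k$-th coordinates of $x$ and $y$, for every $k$, $x\in A$, $y\in B$. Suppose that each $\varphi_k:\pi_k(A)\times\pi_k(B)\to\mathbb R$ is continuously differentiable with positive partial derivatives, that is, there are continuous functions $\frac{\partial\varphi_k}{\partial x_k},\frac{\partial\varphi_k}{\partial y_k}:\pi_k(A)\times\pi_k(B)\to(0,+\infty)$ such that for every $(s,t)\in\pi_k(A)\times\pi_k(B)$, $$\varphi_k(s',t')=\varphi_k(s,t)+\frac{\partial\varphi_k}{\partial x_k}(s,t)\,(s'-s)+\frac{\partial\varphi_k}{\partial y_k}(s,t)\,(t'-t)+o(|s'-s|+|t'-t|)$$ as $(s',t')\to(s,t)$ within $\pi_k(A)\times\pi_k(B)$. Suppose also that each $\varphi_k$ is nondecreasing in each of its two variables on $\pi_k(A)\times\pi_k(B)$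 (this is automatic when $\pi_k(A)$ and $\pi_k(B)$ are intervals, or when $\varphi_k$ extends to a continuously differentiable function with positive partial derivatives on a product of two intervals). Let $\Phi:[0,+\infty)\times[0,+\infty)\to[0,+\infty)$ be continuous, homogeneous of degree $1$, and increasing (in the weak sense, i.e. nondecreasing) in each variable. If $$\prod_{k=1}^n\left(\frac{\partial\varphi_k}{\partial x_k}(x_k,y_k)\,\rho_k+\frac{\partial\varphi_k}{\partial y_k}(x_k,y_k)\,\eta_k\right)\ \ge\ \Phi\left(\prod_{k=1}^n\rho_k,\ \prod_{k=1}^n\eta_k\right)$$ for all $x\in A$, $y\in B$ and all $\rho_1,\dots,\rho_n,\eta_1,\dots,\eta_n>0$, then $$|\varphi(A,B)|\ \ge\ \Phi(|A|,|B|),$$ where $|\cdot|$ denotes Lebesgue measure and $\varphi(A,B)=\{\varphi(x,y):x\in A,\ y\in B\}$. -/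

import Mathlib

open MeasureTheory
open scoped NNReal ENNReal

/-- The projection `π_k(A) = {x_k : x ∈ A}` of a set `A ⊆ ℝⁿ` to the `k`-th coordinate axis. -/
def coordProj {n : ℕ} (k : Fin n) (A : Set (EuclideanSpace ℝ (Fin n))) : Set ℝ :=
  (fun x : EuclideanSpace ℝ (Fin n) => x k) '' A

/-- `f`, a function of two real variables, is continuously differentiable on the (arbitrary) set
`S ⊆ ℝ²`, with partial derivatives `p = ∂f/∂s` and `q = ∂f/∂t` there: `p` and `q` are continuous
on `S` and, at each `z ∈ S`, `f (w) = f (z) + p (z) (w₁ - z₁) + q (z) (w₂ - z₂) + o(|w - z|)` as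
`w → z` in `S`. Only the values of `f`, `p`, `q` on `S` matter. The partial derivatives are given as
data because the expansion does not determine them at points such as isolated points of `S`. If `f`
is `C¹` near `S`, then its usual partial derivatives qualify. -/
structure IsC1OnWithPartials (f p q : ℝ × ℝ → ℝ) (S : Set (ℝ × ℝ)) : Prop where
  hasFDerivWithinAt : ∀ z ∈ S, HasFDerivWithinAt f
    (p z • ContinuousLinearMap.fst ℝ ℝ ℝ + q z • ContinuousLinearMap.snd ℝ ℝ ℝ) S z
  continuousOn_left : ContinuousOn p S
  continuousOn_right : ContinuousOn q S

open Set Filter Topology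

/-! This is a Knothe-type transport argument, run by induction on the dimension. In one variable,
`exists_monotone_parametrization` supplies monotone maps s, t on (0, 1) with f(s) s' = a and g(t) t'
= b almost everywhere. Along w = ψ(s, t), where w' = p s' + q t', the infinitesimal hypothesis with
ρ = s' and η = t' reads Φ(a, b) ≤ w' h(w). Integrating over (0, 1) and changing variables along the
monotone w gives Φ(a, b) ≤ ∫ h (`le_lintegral_of_infinitesimal_le`). In dimension n + 1, let f, g, h
be the section volumes of A, B and of the image. The section of the image over ψ₀(s, t) contains the
image of the sections of A over s and B over t. The case of dimension n, applied to Φ(ρ ·, η ·) / (p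
ρ + q η), is then exactly the infinitesimal hypothesis, and Fubini turns the integrals into volumes.
-/

/-- A Lipschitz function of a real variable maps null sets to null sets. -/
theorem LipschitzWith.volume_image_eq_zero {F : ℝ → ℝ} {K : ℝ≥0} (hF : LipschitzWith K F)
    {N : Set ℝ} (hN : volume N = 0) : volume (F '' N) = 0 := by
  have h := hF.hausdorffMeasure_image_le (d := 1) zero_le_one N
  rw [hausdorffMeasure_real, hN, mul_zero] at h
  exact le_antisymm h zero_le

/-! ### Monotone transport in one variable -/

/-- A bounded nonnegative density `f` supported in a compact set `S` is the image of a uniform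
density on `(0, 1)` under a monotone function `t`, in the differential form `f (t u) * t' u = ∫ f`;
when `∫ f = 0`, the function `t` is constant. -/
theorem exists_monotone_parametrization {f : ℝ → ℝ≥0} (hf : Measurable f) {M : ℝ≥0}
    (hfM : ∀ x, f x ≤ M) {S : Set ℝ} (hS : IsCompact S) (hSne : S.Nonempty)
    (hfS : ∀ x ∉ S, f x = 0) {a : ℝ≥0} (ha : ∫⁻ x, f x = a) :
    ∃ t t' : ℝ → ℝ, MonotoneOn t (Ioo 0 1) ∧ ∀ᵐ u ∂volume.restrict (Ioo (0 : ℝ) 1),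
      t u ∈ S ∧ HasDerivAt t (t' u) u ∧ 0 ≤ t' u ∧ f (t u) * t' u = a := by
  rcases eq_or_ne a 0 with rfl | ha0
  · obtain ⟨x, hx⟩ := hSne
    exact ⟨fun _ => x, 0, monotoneOn_const, Eventually.of_forall fun u =>
      ⟨hx, by simpa using hasDerivAt_const u x, by simp⟩⟩
  have ha_pos : (0 : ℝ) < a := by positivity
  have hint : Integrable (fun x => (f x : ℝ)) := by
    refine ⟨by fun_prop, ?_⟩
    simp [HasFiniteIntegral, ha]
  have hinta : ∫ x, (f x : ℝ) = a := by
    rw [integral_eq_lintegral_of_nonneg_ae (Eventually.of_forall fun x => by simp) (by fun_prop)]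
    simp [ha]
  obtain ⟨l, hl⟩ := hS.bddBelow
  obtain ⟨r, hr⟩ := hS.bddAbove
  have hlr : l ≤ r := (hl hSne.some_mem).trans (hr hSne.some_mem)
  have hii : ∀ x y, IntervalIntegrable (fun x => (f x : ℝ)) volume x y :=
    fun x y => hint.intervalIntegrable
  -- Starting at `l - 1` rather than `l` keeps all of `S`, including its least point, inside the
  -- half-open interval `(l - 1, r]`.
  set F : ℝ → ℝ := fun x => ∫ y in (l - 1)..x, (f y : ℝ) with hF
  have hsub : ∀ x y, F y - F x = ∫ z in x..y, (f z : ℝ) := fun x y =>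
    intervalIntegral.integral_interval_sub_left (hii _ _) (hii _ _)
  have hmono : Monotone F := by
    intro x y hxy
    have := intervalIntegral.integral_nonneg (μ := volume) hxy (f := fun z => (f z : ℝ))
      (fun z _ => NNReal.coe_nonneg _)
    linarith [hsub x y]
  have hLip : LipschitzWith M F := by
    refine LipschitzWith.of_dist_le_mul fun x y => ?_
    rw [Real.dist_eq, Real.dist_eq, hsub y x]
    have := intervalIntegral.norm_integral_le_of_norm_le_const (a := y) (b := x)
      (f := fun z => (f z : ℝ)) (C := M) (fun z _ => by simpa using hfM z)
    simpa using this
  have hFl : F (l - 1) = 0 := by simp [hF]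
  have hFr : F r = a := by
    rw [hF, ← hinta]
    dsimp only
    rw [intervalIntegral.integral_of_le (by linarith)]
    refine setIntegral_eq_integral_of_forall_compl_eq_zero fun x hx => ?_
    rw [hfS x fun h => hx ⟨by linarith [hl h], hr h⟩, NNReal.coe_zero]
  -- `F` may have flat pieces, so `t` is only some right inverse, `F (t u) = a * u`. Any choice is
  -- monotone, because `F` is monotone and `a * u` is strictly increasing.
  have hex : ∀ u : ℝ, ∃ x, u ∈ Ioo (0 : ℝ) 1 → F x = a * u := by
    intro u
    by_cases hu : u ∈ Ioo (0 : ℝ) 1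
    · have : a * u ∈ Icc (F (l - 1)) (F r) := by
        rw [hFl, hFr]
        exact ⟨by have := hu.1; positivity, by nlinarith [hu.2]⟩
      obtain ⟨x, -, hx⟩ := intermediate_value_Icc (by linarith) hLip.continuous.continuousOn this
      exact ⟨x, fun _ => hx⟩
    · exact ⟨0, fun h => absurd h hu⟩
  choose t ht using hex
  have htm : MonotoneOn t (Ioo 0 1) := by
    intro u hu v hv huv
    rcases huv.eq_or_lt with rfl | huv
    · exact le_rfl
    · refine le_of_lt (hmono.reflect_lt ?_)
      rw [ht u hu, ht v hv]
      gcongr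
  refine ⟨t, deriv t, htm, ?_⟩
  -- The points where `F' = f` fails form a null set, whose image under the Lipschitz `F` is null.
  -- Hence `F (t u) = a * u` avoids that image for almost every `u`, so `t u` is a good point.
  have hN := LocallyIntegrable.ae_hasDerivAt_integral hint.locallyIntegrable
  rw [ae_iff] at hN
  have hN' := hLip.volume_image_eq_zero hN
  have hP : ∀ᵐ u : ℝ, (a : ℝ) * u ∉ F '' {x | ¬∀ c,
      HasDerivAt (fun x => ∫ y in c..x, (f y : ℝ)) (f x) x} := by
    rw [ae_iff]
    simp only [not_not]
    change volume (((a : ℝ) * ·) ⁻¹' _) = 0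
    rw [Real.volume_preimage_mul_left ha_pos.ne', hN', mul_zero]
  rw [ae_restrict_iff' measurableSet_Ioo]
  filter_upwards [hP, htm.ae_differentiableWithinAt_of_mem] with u hu hd huI
  have hdt : HasDerivAt t (deriv t u) u :=
    ((hd huI).differentiableAt (Ioo_mem_nhds huI.1 huI.2)).hasDerivAt
  have hFd : HasDerivAt F (f (t u)) (t u) := by
    by_contra hcon
    exact hu ⟨t u, fun h => hcon (h _), ht u huI⟩
  have heq : (f (t u) : ℝ) * deriv t u = a := by
    refine (hFd.comp u hdt).unique ?_
    have : HasDerivAt (fun u : ℝ => (a : ℝ) * u) a u := by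
      simpa using (hasDerivAt_id u).const_mul (a : ℝ)
    refine this.congr_of_eventuallyEq ?_
    filter_upwards [Ioo_mem_nhds huI.1 huI.2] with v hv using ht v hv
  have hpos : 0 < (f (t u) : ℝ) * deriv t u := heq ▸ ha_pos
  refine ⟨?_, hdt, (pos_of_mul_pos_right hpos (NNReal.coe_nonneg _)).le, heq⟩
  -- Since `a > 0`, the density is nonzero at `t u`, which forces `t u ∈ S`.
  by_contra hcon
  simp [hfS _ hcon] at hpos

/-- The one-dimensional transport inequality: if `h` at `ψ (s, t)` dominates the densities `f s` and
`g t` infinitesimally through `Φ`, then `∫ h` dominates `∫ f` and `∫ g` through `Φ`. -/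
theorem le_lintegral_of_infinitesimal_le {f g : ℝ → ℝ≥0} {h : ℝ → ℝ≥0∞} (hf : Measurable f)
    (hg : Measurable g) {M N : ℝ≥0} (hfM : ∀ x, f x ≤ M) (hgN : ∀ x, g x ≤ N)
    {S T : Set ℝ} (hS : IsCompact S) (hT : IsCompact T) (hSne : S.Nonempty) (hTne : T.Nonempty)
    (hfS : ∀ x ∉ S, f x = 0) (hgT : ∀ x ∉ T, g x = 0) {a b : ℝ≥0} (ha : ∫⁻ x, f x = a)
    (hb : ∫⁻ x, g x = b) (hh : ∀ x, h x ≠ ∞) {ψ p q : ℝ × ℝ → ℝ}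
    (hψ : ∀ z ∈ S ×ˢ T, HasFDerivWithinAt ψ
      (p z • ContinuousLinearMap.fst ℝ ℝ ℝ + q z • ContinuousLinearMap.snd ℝ ℝ ℝ) (S ×ˢ T) z)
    (hp : ∀ z ∈ S ×ˢ T, 0 < p z) (hq : ∀ z ∈ S ×ˢ T, 0 < q z)
    (hψl : ∀ t ∈ T, MonotoneOn (fun s => ψ (s, t)) S)
    (hψr : ∀ s ∈ S, MonotoneOn (fun t => ψ (s, t)) T)
    {Φ : ℝ≥0 → ℝ≥0 → ℝ≥0} (hΦl : ∀ b, Monotone (fun a => Φ a b)) (hΦr : ∀ a, Monotone (Φ a))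
    (hle : ∀ s ∈ S, ∀ t ∈ T, ∀ ρ η : ℝ≥0, 0 < ρ → 0 < η → (Φ (ρ * f s) (η * g t) : ℝ≥0∞) ≤
      ENNReal.ofReal (p (s, t) * ρ + q (s, t) * η) * h (ψ (s, t))) :
    (Φ a b : ℝ≥0∞) ≤ ∫⁻ x, h x := by
  obtain ⟨s, s', hsm, hs⟩ := exists_monotone_parametrization hf hfM hS hSne hfS ha
  obtain ⟨t, t', htm, ht⟩ := exists_monotone_parametrization hg hgN hT hTne hgT hb
  obtain ⟨V, hV, hVmeas, hVae⟩ := (hs.and ht).exists_measurable_mem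
  set U := Ioo (0 : ℝ) 1 ∩ V with hU
  have hUmeas : MeasurableSet U := measurableSet_Ioo.inter hVmeas
  have hUvol : volume U = 1 := by
    rw [hU, inter_comm, ← Measure.restrict_apply hVmeas, measure_congr (eventuallyEq_univ.2 hV)]
    simp
  set w : ℝ → ℝ := fun u => ψ (s u, t u)
  set w' : ℝ → ℝ := fun u => p (s u, t u) * s' u + q (s u, t u) * t' u
  -- The expansion of `ψ` holds only within `S ×ˢ T`, so `w` is differentiated within `U`, which the
  -- curve sends into `S ×ˢ T`.
  have hw' : ∀ u ∈ U, HasDerivWithinAt w (w' u) U u := by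
    intro u hu
    obtain ⟨⟨h1, h2, -, -⟩, ⟨h5, h6, -, -⟩⟩ := hVae u hu.2
    have hmaps : MapsTo (fun v => (s v, t v)) U (S ×ˢ T) :=
      fun v hv => ⟨(hVae v hv.2).1.1, (hVae v hv.2).2.1⟩
    have := (hψ (s u, t u) ⟨h1, h5⟩).comp_hasDerivWithinAt u
      (h2.hasDerivWithinAt.prodMk h6.hasDerivWithinAt) hmaps
    exact this.congr_deriv (by simp [w'])
  -- The comparison passes through the corner `(s v, t u)`. Positive partial derivatives alone would
  -- not control `ψ` across gaps of `S` and `T`.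
  have hwm : MonotoneOn w U := by
    intro u hu v hv huv
    have hu' := hVae u hu.2
    have hv' := hVae v hv.2
    exact (hψl _ hu'.2.1 hu'.1.1 hv'.1.1 (hsm hu.1 hv.1 huv)).trans
      (hψr _ hv'.1.1 hu'.2.1 hv'.2.1 (htm hu.1 hv.1 huv))
  have hpt : ∀ u ∈ U, (Φ a b : ℝ≥0∞) ≤ ENNReal.ofReal (w' u) * h (w u) := by
    intro u hu
    obtain ⟨⟨h1, -, h3, h4⟩, ⟨h5, -, h7, h8⟩⟩ := hVae u hu.2
    have hP := hp (s u, t u) ⟨h1, h5⟩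
    have hQ := hq (s u, t u) ⟨h1, h5⟩
    -- `hle` needs positive weights, whereas `s' u` or `t' u` vanishes when `a` or `b` is zero; both
    -- are shifted by `ε`, and then `ε → 0`.
    have hlim : Tendsto (fun ε : ℝ => ENNReal.ofReal
        (p (s u, t u) * (s' u + ε) + q (s u, t u) * (t' u + ε)) * h (w u)) (𝓝[>] 0)
        (𝓝 (ENNReal.ofReal (w' u) * h (w u))) := by
      refine ENNReal.Tendsto.mul_const (ENNReal.tendsto_ofReal ?_) (Or.inr (hh _))
      refine Tendsto.mono_left ?_ nhdsWithin_le_nhds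
      refine Continuous.tendsto' (by fun_prop) _ _ (by simp [w'])
    refine ge_of_tendsto hlim ?_
    filter_upwards [self_mem_nhdsWithin] with ε (hε : 0 < ε)
    obtain ⟨ρ, hρ⟩ : ∃ ρ : ℝ≥0, (ρ : ℝ) = s' u + ε := ⟨_, Real.coe_toNNReal _ (by positivity)⟩
    obtain ⟨η, hη⟩ : ∃ η : ℝ≥0, (η : ℝ) = t' u + ε := ⟨_, Real.coe_toNNReal _ (by positivity)⟩
    have key := hle _ h1 _ h5 ρ η (by rw [← NNReal.coe_pos, hρ]; positivity)
      (by rw [← NNReal.coe_pos, hη]; positivity)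
    rw [hρ, hη] at key
    refine le_trans ?_ key
    have e1 : a ≤ ρ * f (s u) := by
      rw [← NNReal.coe_le_coe, ← h4, NNReal.coe_mul, hρ]
      nlinarith [NNReal.coe_nonneg (f (s u))]
    have e2 : b ≤ η * g (t u) := by
      rw [← NNReal.coe_le_coe, ← h8, NNReal.coe_mul, hη]
      nlinarith [NNReal.coe_nonneg (g (t u))]
    exact_mod_cast (hΦl b e1).trans (hΦr _ e2)
  calc (Φ a b : ℝ≥0∞) = ∫⁻ _ in U, (Φ a b : ℝ≥0∞) := by simp [hUvol]
    _ ≤ ∫⁻ u in U, ENNReal.ofReal (w' u) * h (w u) := setLIntegral_mono' hUmeas hpt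
    _ = ∫⁻ x in w '' U, h x :=
      (lintegral_image_eq_lintegral_deriv_mul_of_monotoneOn hUmeas hw' hwm h).symm
    _ ≤ ∫⁻ x, h x := setLIntegral_le_lintegral _ _

/-! ### Sections over the zeroth coordinate and Fubini -/

/-- The section of `A ⊆ ℝⁿ⁺¹` over the value `t` of the zeroth coordinate. -/
def consSection {n : ℕ} (t : ℝ) (A : Set (Fin (n + 1) → ℝ)) : Set (Fin n → ℝ) :=
  {y | (Fin.cons t y : Fin (n + 1) → ℝ) ∈ A}

section consSection

variable {n : ℕ} {A : Set (Fin (n + 1) → ℝ)}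

theorem isCompact_consSection (hA : IsCompact A) (t : ℝ) : IsCompact (consSection t A) := by
  refine IsCompact.of_isClosed_subset (hA.image (f := Fin.tail) (by unfold Fin.tail; fun_prop))
    (hA.isClosed.preimage (f := fun y => (Fin.cons t y : Fin (n + 1) → ℝ)) (by fun_prop)) ?_
  exact fun y hy => ⟨_, hy, Fin.tail_cons _ _⟩

theorem consSection_subset_tail_image (t : ℝ) : consSection t A ⊆ Fin.tail '' A :=
  fun _ hy => ⟨_, hy, Fin.tail_cons _ _⟩

theorem consSection_nonempty {s : ℝ} (hs : s ∈ Function.eval 0 '' A) :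
    (consSection s A).Nonempty := by
  obtain ⟨x, hx, rfl⟩ := hs
  exact ⟨Fin.tail x, by simpa [consSection] using hx⟩

theorem consSection_eq_empty {s : ℝ} (hs : s ∉ Function.eval 0 '' A) : consSection s A = ∅ :=
  eq_empty_of_forall_notMem fun _ hy => hs ⟨_, hy, rfl⟩

theorem eval_image_consSection_subset (s : ℝ) (k : Fin n) :
    Function.eval k '' consSection s A ⊆ Function.eval k.succ '' A := by
  rintro _ ⟨y, hy, rfl⟩
  exact ⟨_, hy, by simp⟩

theorem consSection_eq_preimage (t : ℝ) : consSection t A = Prod.mk t ⁻¹'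
    ((MeasurableEquiv.piFinSuccAbove (fun _ : Fin (n + 1) => ℝ) 0).symm ⁻¹' A) := by
  ext y
  simp [consSection, MeasurableEquiv.piFinSuccAbove, Fin.consEquiv]

theorem measurable_volume_consSection (hA : MeasurableSet A) :
    Measurable fun t => volume (consSection t A) := by
  simp only [consSection_eq_preimage]
  exact measurable_measure_prodMk_left
    ((MeasurableEquiv.piFinSuccAbove (fun _ : Fin (n + 1) => ℝ) 0).symm.measurable hA)

theorem lintegral_volume_consSection (hA : MeasurableSet A) :
    ∫⁻ t, volume (consSection t A) = volume A := by
  have e := (volume_preserving_piFinSuccAbove (fun _ : Fin (n + 1) => ℝ) 0).symm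
  rw [← e.measure_preimage hA.nullMeasurableSet, Measure.volume_eq_prod,
    Measure.prod_apply (e.measurable hA)]
  simp only [consSection_eq_preimage]

theorem volume_consSection_ne_top (hA : IsCompact A) (t : ℝ) : volume (consSection t A) ≠ ∞ :=
  (isCompact_consSection hA t).measure_ne_top

/-- All sections lie in one compact projection. This uniform bound on the density is what makes its
cumulative integral Lipschitz. -/
theorem toNNReal_volume_consSection_le (hA : IsCompact A) (t : ℝ) :
    (volume (consSection t A)).toNNReal ≤ (volume (Fin.tail '' A)).toNNReal :=
  ENNReal.toNNReal_mono (hA.image (by unfold Fin.tail; fun_prop)).measure_ne_top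
    (measure_mono (consSection_subset_tail_image t))

theorem lintegral_toNNReal_volume_consSection (hA : IsCompact A) :
    ∫⁻ t, ((volume (consSection t A)).toNNReal : ℝ≥0∞) = (volume A).toNNReal := by
  rw [ENNReal.coe_toNNReal hA.measure_ne_top, ← lintegral_volume_consSection hA.measurableSet]
  simp only [ENNReal.coe_toNNReal (volume_consSection_ne_top hA _)]

end consSection

/-! ### Induction on the dimension -/

/-- The image of two compact sets under a coordinatewise map is compact. -/
theorem isCompact_image2_coordinatewise {ι : Type*} {A B : Set (ι → ℝ)} (hA : IsCompact A)
    (hB : IsCompact B) {ψ : ι → ℝ × ℝ → ℝ}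
    (hψ : ∀ k, ContinuousOn (ψ k) ((Function.eval k '' A) ×ˢ (Function.eval k '' B))) :
    IsCompact (image2 (fun x y k => ψ k (x k, y k)) A B) := by
  rw [← image_uncurry_prod]
  refine (hA.prod hB).image_of_continuousOn (continuousOn_pi.2 fun k => ?_)
  refine (hψ k).comp (f := fun z : (ι → ℝ) × (ι → ℝ) => (z.1 k, z.2 k)) (by fun_prop) ?_
  exact fun z hz => ⟨⟨_, hz.1, rfl⟩, ⟨_, hz.2, rfl⟩⟩

/-- The volume inequality for coordinatewise maps of compact subsets of `Fin n → ℝ`, by induction on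
`n`: sections over the zeroth coordinate are compared through the functions
`(a, b) ↦ Φ (ρ * a) (η * b) / (p * ρ + q * η)`. Neither continuity nor homogeneity of `Φ` is used. -/
theorem le_volume_image2_coordinatewise (n : ℕ) {A B : Set (Fin n → ℝ)} (hA : IsCompact A)
    (hB : IsCompact B) (hA_ne : A.Nonempty) (hB_ne : B.Nonempty) {ψ p q : Fin n → ℝ × ℝ → ℝ}
    (hψ : ∀ k, ∀ z ∈ (Function.eval k '' A) ×ˢ (Function.eval k '' B), HasFDerivWithinAt (ψ k)
      (p k z • ContinuousLinearMap.fst ℝ ℝ ℝ + q k z • ContinuousLinearMap.snd ℝ ℝ ℝ)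
      ((Function.eval k '' A) ×ˢ (Function.eval k '' B)) z)
    (hp : ∀ k, ∀ z ∈ (Function.eval k '' A) ×ˢ (Function.eval k '' B), 0 < p k z)
    (hq : ∀ k, ∀ z ∈ (Function.eval k '' A) ×ˢ (Function.eval k '' B), 0 < q k z)
    (hψl : ∀ k, ∀ t ∈ Function.eval k '' B,
      MonotoneOn (fun s => ψ k (s, t)) (Function.eval k '' A))
    (hψr : ∀ k, ∀ s ∈ Function.eval k '' A,
      MonotoneOn (fun t => ψ k (s, t)) (Function.eval k '' B))
    {Φ : ℝ≥0 → ℝ≥0 → ℝ≥0} (hΦl : ∀ b, Monotone (fun a => Φ a b)) (hΦr : ∀ a, Monotone (Φ a))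
    (hcond : ∀ x ∈ A, ∀ y ∈ B, ∀ ρ η : Fin n → ℝ≥0, (∀ k, 0 < ρ k) → (∀ k, 0 < η k) →
      (Φ (∏ k, ρ k) (∏ k, η k) : ℝ) ≤
        ∏ k, (p k (x k, y k) * (ρ k : ℝ) + q k (x k, y k) * (η k : ℝ))) :
    (Φ (volume A).toNNReal (volume B).toNNReal : ℝ≥0∞) ≤
      volume (image2 (fun x y k => ψ k (x k, y k)) A B) := by
  -- The inductive step changes `Φ`, absorbing the zeroth factor of the product into it.
  induction n generalizing Φ with
  | zero =>
    -- All sets are the one-point space of volume 1, and the empty products give `Φ 1 1 ≤ 1`.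
    obtain ⟨x, hx⟩ := hA_ne
    obtain ⟨y, hy⟩ := hB_ne
    have h1 := hcond x hx y hy 1 1 (by simp) (by simp)
    rw [Set.Nonempty.eq_univ (Set.Nonempty.image2 ⟨x, hx⟩ ⟨y, hy⟩),
      Set.Nonempty.eq_univ ⟨x, hx⟩, Set.Nonempty.eq_univ ⟨y, hy⟩]
    simpa [volume_pi, Measure.pi_of_empty] using h1
  | succ n ih =>
    have hC := isCompact_image2_coordinatewise hA hB (ψ := ψ)
      fun k z hz => (hψ k z hz).continuousWithinAt
    set C := image2 (fun x y k => ψ k (x k, y k)) A B with hCdef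
    rw [← lintegral_volume_consSection hC.measurableSet]
    refine le_lintegral_of_infinitesimal_le
      (f := fun t => (volume (consSection t A)).toNNReal)
      (g := fun t => (volume (consSection t B)).toNNReal)
      (measurable_volume_consSection hA.measurableSet).ennreal_toNNReal
      (measurable_volume_consSection hB.measurableSet).ennreal_toNNReal
      (toNNReal_volume_consSection_le hA) (toNNReal_volume_consSection_le hB)
      (hA.image (continuous_apply 0)) (hB.image (continuous_apply 0))
      (hA_ne.image _) (hB_ne.image _)
      (fun x hx => by simp [consSection_eq_empty hx])
      (fun x hx => by simp [consSection_eq_empty hx])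
      (lintegral_toNNReal_volume_consSection hA) (lintegral_toNNReal_volume_consSection hB)
      (volume_consSection_ne_top hC) (hψ 0) (hp 0) (hq 0) (hψl 0) (hψr 0) hΦl hΦr ?_
    intro s hs t ht ρ η hρ hη
    have hpos : 0 < p 0 (s, t) * ρ + q 0 (s, t) * η := by
      have := hp 0 (s, t) ⟨hs, ht⟩
      have := hq 0 (s, t) ⟨hs, ht⟩
      positivity
    set D : ℝ≥0 := (p 0 (s, t) * ρ + q 0 (s, t) * η).toNNReal with hD
    have hDpos : 0 < D := Real.toNNReal_pos.2 hpos
    have hDcoe : (D : ℝ) = p 0 (s, t) * ρ + q 0 (s, t) * η := Real.coe_toNNReal _ hpos.le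
    have hsubA := eval_image_consSection_subset (A := A) s
    have hsubB := eval_image_consSection_subset (A := B) t
    have key := ih (A := consSection s A) (B := consSection t B)
      (isCompact_consSection hA s) (isCompact_consSection hB t)
      (consSection_nonempty hs) (consSection_nonempty ht)
      (ψ := fun k => ψ k.succ) (p := fun k => p k.succ) (q := fun k => q k.succ)
      (fun k z hz => (hψ k.succ z (prod_mono (hsubA k) (hsubB k) hz)).mono
        (prod_mono (hsubA k) (hsubB k)))
      (fun k z hz => hp k.succ z (prod_mono (hsubA k) (hsubB k) hz))
      (fun k z hz => hq k.succ z (prod_mono (hsubA k) (hsubB k) hz))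
      (fun k t ht => (hψl k.succ t (hsubB k ht)).mono (hsubA k))
      (fun k s hs => (hψr k.succ s (hsubA k hs)).mono (hsubB k))
      (Φ := fun a b => Φ (ρ * a) (η * b) / D)
      (fun b a a' h => by dsimp only; gcongr; exact hΦl _ (by gcongr))
      (fun a b b' h => by dsimp only; gcongr; exact hΦr _ (by gcongr)) ?_
    · rw [ENNReal.coe_div hDpos.ne', ENNReal.div_le_iff (by simpa using hDpos.ne') (by simp),
        mul_comm _ (D : ℝ≥0∞)] at key
      -- Prepending `s` and `t` to points of the two sections puts their image in the section of `C`
      -- over `ψ 0 (s, t)`.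
      refine key.trans (mul_le_mul_right (measure_mono ?_) _)
      rintro _ ⟨x, hx, y, hy, rfl⟩
      refine ⟨_, hx, _, hy, ?_⟩
      ext k
      refine Fin.cases ?_ (fun k => ?_) k <;> simp
    -- The hypothesis for the weights extended by `ρ` and `η` has zeroth factor `D`; dividing by it
    -- gives the hypothesis for the new `Φ`.
    · intro x hx y hy ρ' η' hρ' hη'
      have h := hcond _ hx _ hy (Fin.cons ρ ρ') (Fin.cons η η')
        (fun k => Fin.cases (by simpa using hρ) (by simpa using hρ') k)
        (fun k => Fin.cases (by simpa using hη) (by simpa using hη') k)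
      simp only [Fin.prod_univ_succ, Fin.cons_zero, Fin.cons_succ] at h
      rw [NNReal.coe_div, div_le_iff₀' (by exact_mod_cast hDpos), hDcoe]
      exact h

/-! ### Transfer from `Fin n → ℝ` to Euclidean space -/

theorem coordProj_eq_eval_image {n : ℕ} (k : Fin n) (A : Set (EuclideanSpace ℝ (Fin n))) :
    coordProj k A = Function.eval k '' (WithLp.ofLp '' A) := by
  rw [image_image]
  rfl

theorem EuclideanSpace.volume_ofLp_image {ι : Type*} [Fintype ι] (A : Set (EuclideanSpace ℝ ι)) :
    volume (WithLp.ofLp '' A) = volume A := by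
  have e := EuclideanSpace.volume_preserving_symm_measurableEquiv_toLp ι
  rw [← e.measure_preimage_equiv]
  congr 1
  exact preimage_image_eq A (MeasurableEquiv.toLp 2 (ι → ℝ)).symm.injective

theorem corollary1p2 (n : ℕ) (A B : Set (EuclideanSpace ℝ (Fin n)))
    (hA : IsCompact A) (hB : IsCompact B) (hA_ne : A.Nonempty) (hB_ne : B.Nonempty)
    -- the map `φ` on `A × B`, with `φ_k(x, y) = φ_k(x_k, y_k)`
    (φ : EuclideanSpace ℝ (Fin n) → EuclideanSpace ℝ (Fin n) → EuclideanSpace ℝ (Fin n))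
    (φc : Fin n → ℝ × ℝ → ℝ)
    (hφ : ∀ x ∈ A, ∀ y ∈ B, ∀ k, φ x y k = φc k (x k, y k))
    -- `φ` is continuously differentiable with positive partial derivatives `dx k`, `dy k`
    (dx dy : Fin n → ℝ × ℝ → ℝ)
    (hφ_C1 : ∀ k, IsC1OnWithPartials (φc k) (dx k) (dy k) (coordProj k A ×ˢ coordProj k B))
    (hdx_pos : ∀ k, ∀ z ∈ coordProj k A ×ˢ coordProj k B, 0 < dx k z)
    (hdy_pos : ∀ k, ∀ z ∈ coordProj k A ×ˢ coordProj k B, 0 < dy k z)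
    -- each `φ_k` is nondecreasing in each variable, also across gaps of the projections
    (hφ_mono_left : ∀ k, ∀ t ∈ coordProj k B, MonotoneOn (fun s => φc k (s, t)) (coordProj k A))
    (hφ_mono_right : ∀ k, ∀ s ∈ coordProj k A, MonotoneOn (fun t => φc k (s, t)) (coordProj k B))
    -- `Φ` is continuous, homogeneous of degree 1 and increasing in each variable
    (Φ : ℝ≥0 → ℝ≥0 → ℝ≥0)
    (hΦ_cont : Continuous (fun z : ℝ≥0 × ℝ≥0 => Φ z.1 z.2))
    (hΦ_hom : ∀ c : ℝ≥0, 0 < c → ∀ a b : ℝ≥0, Φ (c * a) (c * b) = c * Φ a b)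
    (hΦ_mono_left : ∀ b, Monotone (fun a => Φ a b))
    (hΦ_mono_right : ∀ a, Monotone (fun b => Φ a b))
    (hcond : ∀ x ∈ A, ∀ y ∈ B, ∀ ρ η : Fin n → ℝ≥0, (∀ k, 0 < ρ k) → (∀ k, 0 < η k) →
      (Φ (∏ k, ρ k) (∏ k, η k) : ℝ) ≤
        ∏ k, (dx k (x k, y k) * (ρ k : ℝ) + dy k (x k, y k) * (η k : ℝ))) :
    (Φ (volume A).toNNReal (volume B).toNNReal : ℝ≥0∞) ≤ volume (Set.image2 φ A B) := by
  have hcont : Continuous (WithLp.ofLp : EuclideanSpace ℝ (Fin n) → Fin n → ℝ) := by fun_prop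
  have hψ := fun k => (hφ_C1 k).hasFDerivWithinAt
  simp only [coordProj_eq_eval_image] at *
  have key := le_volume_image2_coordinatewise n (hA.image hcont) (hB.image hcont)
    (hA_ne.image _) (hB_ne.image _) hψ hdx_pos hdy_pos hφ_mono_left hφ_mono_right
    hΦ_mono_left hΦ_mono_right (by
      rintro _ ⟨x, hx, rfl⟩ _ ⟨y, hy, rfl⟩
      exact hcond x hx y hy)
  rw [EuclideanSpace.volume_ofLp_image, EuclideanSpace.volume_ofLp_image] at key
  refine key.trans_eq ?_
  rw [← EuclideanSpace.volume_ofLp_image (image2 φ A B), image2_image_left, image2_image_right,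
    image_image2]
  exact congrArg _ (image2_congr fun x hx y hy => funext fun k => (hφ x hx y hy k).symm)
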